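/- Fix an algebraic closure $\overline{\mathbb Q}$ of $\mathbb Q$ and let $G_{\mathbb Q}=\mathrm{Gal}(\overline{\mathbb Q}/\mathbb Q)$. Let $E/\mathbb Q$ be an elliptic curve, and for $n\ge 1$ let $\rho_{E,n}\colon G_{\mathbb Q}\to \mathrm{Aut}(E[n])$ be the Galois representation on the $n$-torsion of $E(\overline{\mathbb Q})$; for a prime $\ell$ let $\rho_{E,\ell^\infty}\colon G_{\mathbb Q}\to\mathrm{Aut}(T_\ell E)\cong \mathrm{GL}(2,\mathbb Z_\ell)$ be the representation on the $\ell$-adic Tate module. Let $\mathbb Q(E[n])$ be the fixed field of $\ker\rho_{E,n}$, let $\mathbb Q(\zeta_n)$ be the $n$-th cyclotomic field and $\mathbb Q^{\mathrm{ab}}$ the maximal abelian extension of $\mathbb Q$, all inside $\overline{\mathbb Q}$. Let $\Delta_E\in\mathbb Z$ be the discriminant of an integral Weierstrass model of $E$ (for instance the minimal discriminant). For integers $0<a<b$ with $d=\gcd(a,b)$, put $K_a=\mathbb Q(E[a])\cap\mathbb Q^{\mathrm{ab}}$ and $K_b=\mathbb Q(E[b])\cap\mathbb Q^{\mathrm{ab}}$.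 For a non-trivial finite abelian group $T$, $E$ has a *Weil $(a,b)$-entanglement of type $T$* if $\mathrm{Gal}(K_a\cap\mathbb Q(\zeta_b)/\mathbb Q(\zeta_d))\cong T$ or $\mathrm{Gal}(K_b\cap\mathbb Q(\zeta_a)/\mathbb Q(\zeta_d))\cong T$. **Theorem.** 1. If $\Delta_E$ is not a square in $\mathbb Q^\times$, then $E/\mathbb Q$ has a Weil $(2,4|\Delta_E|)$-entanglement of type $\mathbb Z/2\mathbb Z$ (a Serre entanglement), and $\mathbb Q(E[2])\cap\mathbb Q(\zeta_{4|\Delta_E|})=\mathbb Q(\sqrt{\Delta_E})$. 2. If $\Delta_E$ is a square in $\mathbb Q^\times$, then $E$ has a vertical tanglement at $2$: the $2$-adic representation $\rho_{E,2^\infty}$ is not surjective; indeed already $\rho_{E,2}$ is not surjective. Moreover, for all integers $\delta,\phi$ and every $\mathbb Z_2$-basis of $T_2E$, the image of $\rho_{E,2^\infty}$ in $\mathrm{GL}(2,\mathbb Z_2)$ is not equal to $\mathcal N_{\delta,\phi}(2^\infty)=\varprojlim_k \mathcal N_{\delta,\phi}(2^k)$, where $\mathcal N_{\delta,\phi}(n)\subseteq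 \mathrm{GL}(2,\mathbb Z/n\mathbb Z)$ is the subgroup generated by the invertible matrices $\begin{pmatrix} a+b\phi & b\\ \delta b& a\end{pmatrix}$ with $a,b\in\mathbb Z/n\mathbb Z$, and by $\begin{pmatrix}-1&0\\ \phi&1\end{pmatrix}$. (So the $2$-adic image is also smaller than the generic one when $E$ has complex multiplication.) -/

import Mathlib

noncomputable section

namespace EllipticEntanglement

/-- The fixed algebraic closure of `ℚ`. -/
abbrev QBar : Type := AlgebraicClosure ℚ

/-- The absolute Galois group of `ℚ`. -/
abbrev GQ : Type := QBar ≃ₐ[ℚ] QBar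

/-! ### Subfields of the algebraic closure -/

/-- The cyclotomic field `ℚ(ζ_n)`, generated by all `n`-th roots of unity. -/
def cyclo (n : ℕ) : IntermediateField ℚ QBar :=
  IntermediateField.adjoin ℚ {z : QBar | z ^ n = 1}

/-- The field `ℚ(√q)`, generated by the square roots of `q`. -/
def sqrtField (q : ℚ) : IntermediateField ℚ QBar :=
  IntermediateField.adjoin ℚ {z : QBar | z ^ 2 = algebraMap ℚ QBar q}

/-- The maximal abelian extension of `ℚ`: the compositum of all abelian extensions. -/
def qAb : IntermediateField ℚ QBar :=
  ⨆ (K : IntermediateField ℚ QBar) (_ : IsAbelianGalois ℚ K), K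

/-! ### Galois representations -/

instance : DecidableEq QBar := Classical.decEq _

/-- The group `E(ℚ̄)`. -/
abbrev Pts (E : WeierstrassCurve ℚ) : Type := (E.baseChange QBar).toAffine.Point

/-- The action of the absolute Galois group on `E(ℚ̄)`, through the coordinates. -/
def galPoint (E : WeierstrassCurve ℚ) (σ : GQ) : Pts E →+ Pts E :=
  WeierstrassCurve.Affine.Point.map (W' := E.toAffine) σ.toAlgHom

lemma galPoint_one (E : WeierstrassCurve ℚ) (P : Pts E) : galPoint E 1 P = P := by
  rcases P with _ | _ <;> rfl

lemma galPoint_mul (E : WeierstrassCurve ℚ) (σ τ : GQ) (P : Pts E) :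
    galPoint E (σ * τ) P = galPoint E σ (galPoint E τ P) := by
  rcases P with _ | _ <;> rfl

/-- The `n`-torsion subgroup `E[n]` of `E(ℚ̄)`. -/
abbrev tors (E : WeierstrassCurve ℚ) (n : ℕ) : AddSubgroup (Pts E) :=
  AddSubgroup.torsionBy (Pts E) n

/-- The `ℓ`-adic Tate module `T_ℓ E = lim E[ℓ ^ k]`: the sequences `(P k)` with `P k ∈ E[ℓ ^ k]`
and `ℓ • P (k + 1) = P k`. -/
def tate (E : WeierstrassCurve ℚ) (ℓ : ℕ) : AddSubgroup (ℕ → Pts E) where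
  carrier := {P | ∀ k, P k ∈ tors E (ℓ ^ k) ∧ ℓ • P (k + 1) = P k}
  zero_mem' k := ⟨zero_mem _, nsmul_zero ℓ⟩
  add_mem' {P Q} hP hQ k := ⟨add_mem (hP k).1 (hQ k).1, by
    rw [Pi.add_apply, Pi.add_apply, nsmul_add, (hP k).2, (hQ k).2]⟩
  neg_mem' {P} hP k := ⟨neg_mem (hP k).1, by
    rw [Pi.neg_apply, Pi.neg_apply, neg_nsmul, (hP k).2]⟩

lemma galPoint_mem_tors (E : WeierstrassCurve ℚ) (n : ℕ) (σ : GQ) {P : Pts E}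
    (hP : P ∈ tors E n) : galPoint E σ P ∈ tors E n := by
  rw [AddSubgroup.torsionBy.nsmul_iff] at hP ⊢
  rw [← map_nsmul, hP, map_zero]

lemma galPoint_mem_tate (E : WeierstrassCurve ℚ) (ℓ : ℕ) (σ : GQ) {P : ℕ → Pts E}
    (hP : P ∈ tate E ℓ) : (fun k => galPoint E σ (P k)) ∈ tate E ℓ := fun k =>
  ⟨galPoint_mem_tors E _ σ (hP k).1, by rw [← map_nsmul, (hP k).2]⟩

/-- The mod `n` representation `ρ_{E,n} : G_ℚ → Aut(E[n])`; the automorphism group of the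
abelian group `E[n]` is the unit group of its endomorphism ring. -/
def rhoMod (E : WeierstrassCurve ℚ) (n : ℕ) : GQ →* (AddMonoid.End (tors E n))ˣ :=
  MonoidHom.toHomUnits
    { toFun := fun σ =>
        { toFun := fun P => ⟨galPoint E σ P.1, galPoint_mem_tors E n σ P.2⟩
          map_zero' := Subtype.ext (map_zero (galPoint E σ))
          map_add' := fun P Q => Subtype.ext (map_add (galPoint E σ) P.1 Q.1) }
      map_one' := AddMonoidHom.ext fun P => Subtype.ext (galPoint_one E P.1)
      map_mul' := fun σ τ => AddMonoidHom.ext fun P => Subtype.ext (galPoint_mul E σ τ P.1) }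

/-- The `ℓ`-adic representation `ρ_{E,ℓ^∞} : G_ℚ → Aut(T_ℓ E)`. As `T_ℓ E ≅ ℤ_ℓ²`, every
additive automorphism of `T_ℓ E` is `ℤ_ℓ`-linear, so the target is the group that becomes
`GL(2, ℤ_ℓ)` after the choice of a basis. -/
def rhoAdic (E : WeierstrassCurve ℚ) (ℓ : ℕ) : GQ →* (AddMonoid.End (tate E ℓ))ˣ :=
  MonoidHom.toHomUnits
    { toFun := fun σ =>
        { toFun := fun P => ⟨fun k => galPoint E σ (P.1 k), galPoint_mem_tate E ℓ σ P.2⟩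
          map_zero' := Subtype.ext (funext fun _ => map_zero (galPoint E σ))
          map_add' := fun P Q => Subtype.ext (funext fun k =>
            map_add (galPoint E σ) (P.1 k) (Q.1 k)) }
      map_one' := AddMonoidHom.ext fun P => Subtype.ext (funext fun k => galPoint_one E (P.1 k))
      map_mul' := fun σ τ => AddMonoidHom.ext fun P => Subtype.ext (funext fun k =>
        galPoint_mul E σ τ (P.1 k)) }

/-- The `n`-division field `ℚ(E[n])`: the fixed field of the kernel of `ρ_{E,n}`. -/
def divField (E : WeierstrassCurve ℚ) (n : ℕ) : IntermediateField ℚ QBar :=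
  IntermediateField.fixedField (rhoMod E n).ker

/-! ### Entanglements and tanglements -/

/-- `F ≤ K` and the Galois group of `K / F` is isomorphic to `T`. -/
def GalIso (F K : IntermediateField ℚ QBar) (T : Type) [Group T] : Prop :=
  ∃ h : F ≤ K, Nonempty
    ((IntermediateField.extendScalars h ≃ₐ[F] IntermediateField.extendScalars h) ≃* T)

/-- `E` has a Weil `(a, b)`-entanglement of type `T`, where `a < b` are positive integers and
`T` is a non-trivial finite abelian group: with `d = gcd a b`, `K_a = ℚ(E[a]) ∩ ℚ^ab` and
`K_b = ℚ(E[b]) ∩ ℚ^ab`, one of the groups `Gal(K_a ∩ ℚ(ζ_b) / ℚ(ζ_d))` and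
`Gal(K_b ∩ ℚ(ζ_a) / ℚ(ζ_d))` is isomorphic to `T`. -/
def HasWeilEntanglement (E : WeierstrassCurve ℚ) (a b : ℕ) (T : Type)
    [CommGroup T] [Finite T] [Nontrivial T] : Prop :=
  0 < a ∧ a < b ∧
    (GalIso (cyclo (a.gcd b)) ((divField E a ⊓ qAb) ⊓ cyclo b) T ∨
      GalIso (cyclo (a.gcd b)) ((divField E b ⊓ qAb) ⊓ cyclo a) T)

/-- The `ℓ`-adic representation of `E` has a vertical tanglement: it is not surjective. -/
def HasVerticalTanglement (E : WeierstrassCurve ℚ) (ℓ : ℕ) : Prop :=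
  ¬ Function.Surjective (rhoAdic E ℓ)

/-- The image of `ρ_{E,ℓ^∞}` in `GL(2, ℤ_ℓ)`, for the basis of `T_ℓ E` given by `e` (an additive
isomorphism `T_ℓ E ≃ ℤ_ℓ²` is automatically `ℤ_ℓ`-linear). -/
def adicImage (E : WeierstrassCurve ℚ) (ℓ : ℕ) [Fact ℓ.Prime]
    (e : tate E ℓ ≃+ (Fin 2 → ℤ_[ℓ])) : Set (GL (Fin 2) ℤ_[ℓ]) :=
  {g | ∃ σ : GQ, ∀ P : tate E ℓ, e ((rhoAdic E ℓ σ).1 P) = g.1.mulVec (e P)}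

/-- The group `N_{δ,φ}(n)`, generated by the Cartan subgroup `C_{δ,φ}(n)` of the invertible
matrices `[a + bφ, b; δb, a]` and by the matrix `[-1, 0; φ, 1]`. -/
def cartanNormalizer (δ φ : ℤ) (n : ℕ) : Subgroup (GL (Fin 2) (ZMod n)) :=
  Subgroup.closure
    ({g | ∃ a b : ZMod n, g.1 = !![a + b * (φ : ZMod n), b; (δ : ZMod n) * b, a]} ∪
      {g | g.1 = !![-1, 0; (φ : ZMod n), 1]})

/-- The group `N_{δ,φ}(ℓ^∞) = lim N_{δ,φ}(ℓ ^ k)` inside `GL(2, ℤ_ℓ)`. -/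
def cartanNormalizerAdic (δ φ : ℤ) (ℓ : ℕ) [Fact ℓ.Prime] : Subgroup (GL (Fin 2) ℤ_[ℓ]) :=
  ⨅ k : ℕ, (cartanNormalizer δ φ (ℓ ^ k)).comap
    (Matrix.GeneralLinearGroup.map (PadicInt.toZModPow k))

end EllipticEntanglement

end

/-!
Both parts rest on the identity `Δ = (4 ∏_{i < j} (eᵢ - eⱼ)) ^ 2`, where `e₀, e₁, e₂` are the
abscissas of the points of order two (`IsTwoRoots.discr_eq`). The Galois group permutes these points, and an
element induces an even permutation exactly when it fixes `√Δ` (`apply_vandermonde`). A change of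
model multiplies `Δ` by a nonzero square, so the given integral model and `E` itself have the same
`ℚ(√Δ)`.

Suppose `Δ` is not a square. Then some Galois element `τ` induces an odd permutation. An element
`σ` fixing `√Δ` induces an even one, hence has the same image in the symmetric group on three
letters as the commutator `τ σ τ⁻¹ σ⁻¹`, which acts trivially on cyclotomic fields. So `σ` acts
trivially on `ℚ(E[2]) ∩ ℚ(ζ_n)`, which is therefore contained in `ℚ(√Δ)`
(`apply_eq_self_of_mem_divField_of_mem_cyclo`, `divField_inf_cyclo`). Conversely `√Δ` lies in
`ℚ(ζ_{4|Δ|})`: quadratic Gauss sums provide square roots of `±p`, and fourth and eighth roots of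
unity provide those of `-1` and `2` (`mem_cyclo_of_sq_eq_intCast`).

Suppose `Δ` is a square. Then no Galois element interchanges two points of order two
(`not_swap_of_isSquare`). Every point over the algebraic closure is a double, by the explicit
tangent construction in `IsTwoRoots.exists_two_nsmul_eq`, so the two-power torsion has a compatible
basis (`exists_isTwoPowerBasis`). The automorphisms of `E[2]` and of the Tate module which exchange
the two basis vectors are then outside the images of Galois. Finally, for every parity of `δ` and
`φ` the group `N_{δ,φ}(2^∞)` contains a matrix whose reduction modulo two is a transposition
(`adicImage_ne_cartanNormalizerAdic`), and such a matrix in the two-adic image would interchange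
two points of order two, because the kernel of `T₂ E → E[2]` is `2 • T₂ E`
(`exists_mulVec_sub_eq_two_nsmul`).
-/

noncomputable section

namespace EllipticEntanglement

/-! ### The two-torsion cubic -/

section TwoTorsion

variable {F : Type*} [Field F]

/-- The `e i` are the roots, with multiplicity, of the two-torsion cubic
`4 * X ^ 3 + b₂ * X ^ 2 + 2 * b₄ * X + b₆` of `W`, expressed through their elementary symmetric
functions. -/
def IsTwoRoots (W : WeierstrassCurve F) (e : Fin 3 → F) : Prop :=
  W.b₂ = -4 * (e 0 + e 1 + e 2) ∧ W.b₄ = 2 * (e 0 * e 1 + e 0 * e 2 + e 1 * e 2) ∧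
    W.b₆ = -4 * (e 0 * e 1 * e 2)

/-- The product of the differences of a triple. -/
def vandermonde (e : Fin 3 → F) : F := (e 0 - e 1) * (e 0 - e 2) * (e 1 - e 2)

lemma exists_isTwoRoots [IsAlgClosed F] [CharZero F] (W : WeierstrassCurve F) :
    ∃ e, IsTwoRoots W e := by
  have ha : W.twoTorsionPolynomial.a ≠ 0 := by simp [WeierstrassCurve.twoTorsionPolynomial]
  obtain ⟨x, y, z, h⟩ := (Cubic.splits_iff_roots_eq_three (φ := RingHom.id F) ha).1
    (IsAlgClosed.splits _)
  have hb := Cubic.b_eq_three_roots ha h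
  have hc := Cubic.c_eq_three_roots ha h
  have hd := Cubic.d_eq_three_roots ha h
  simp only [WeierstrassCurve.twoTorsionPolynomial, RingHom.id_apply] at hb hc hd
  refine ⟨![x, y, z], ?_, ?_, ?_⟩ <;> simp
  · rw [hb]; ring
  · have h2 : (2 : F) ≠ 0 := two_ne_zero
    apply mul_left_cancel₀ h2
    rw [hc]; ring
  · rw [hd]; ring

variable {W : WeierstrassCurve F} {e : Fin 3 → F}

lemma IsTwoRoots.discr_eq [CharZero F] (h : IsTwoRoots W e) :
    W.Δ = (4 * vandermonde e) ^ 2 := by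
  obtain ⟨h2, h4, h6⟩ := h
  have hr := W.b_relation
  have h8 : W.b₈ = W.b₂ * W.b₆ / 4 - W.b₄ ^ 2 / 4 := by
    field_simp
    linear_combination hr
  rw [WeierstrassCurve.Δ, h8, h2, h4, h6, vandermonde]
  ring

lemma IsTwoRoots.injective [CharZero F] (h : IsTwoRoots W e) (hΔ : W.Δ ≠ 0) :
    Function.Injective e := by
  have : vandermonde e ≠ 0 := by
    rintro h0
    apply hΔ
    rw [h.discr_eq, h0]
    ring
  simp only [vandermonde, mul_ne_zero_iff, sub_ne_zero] at this
  obtain ⟨⟨h1, h2⟩, h3⟩ := this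
  intro i j hij
  fin_cases i <;> fin_cases j <;> simp_all

/-- Completing the square in the Weierstrass equation. -/
lemma IsTwoRoots.equation_iff [CharZero F] (h : IsTwoRoots W e) (x y : F) :
    W.toAffine.Equation x y ↔
      (2 * y + W.a₁ * x + W.a₃) ^ 2 = 4 * ((x - e 0) * (x - e 1) * (x - e 2)) := by
  obtain ⟨h2, h4, h6⟩ := h
  simp only [WeierstrassCurve.b₂, WeierstrassCurve.b₄, WeierstrassCurve.b₆] at h2 h4 h6
  rw [WeierstrassCurve.Affine.equation_iff]
  constructor <;> intro h
  · linear_combination 4 * h + x ^ 2 * h2 + 2 * x * h4 + h6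
  · linear_combination (h - x ^ 2 * h2 - 2 * x * h4 - h6) / 4

lemma IsTwoRoots.cubic_eq_zero_iff [CharZero F] (h : IsTwoRoots W e) (x : F) :
    4 * x ^ 3 + W.b₂ * x ^ 2 + 2 * W.b₄ * x + W.b₆ = 0 ↔ ∃ i, x = e i := by
  obtain ⟨h2, h4, h6⟩ := h
  have : 4 * x ^ 3 + W.b₂ * x ^ 2 + 2 * W.b₄ * x + W.b₆ =
      4 * ((x - e 0) * (x - e 1) * (x - e 2)) := by
    rw [h2, h4, h6]; ring
  rw [this]
  simp [Fin.exists_fin_succ, sub_eq_zero, or_assoc]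

variable [CharZero F]

lemma IsTwoRoots.nonsingular (h : IsTwoRoots W e) (hΔ : W.Δ ≠ 0) (i : Fin 3) :
    W.toAffine.Nonsingular (e i) (-(W.a₁ * e i + W.a₃) / 2) := by
  rw [← WeierstrassCurve.Affine.equation_iff_nonsingular_of_Δ_ne_zero hΔ, h.equation_iff]
  have : (2 * (-(W.a₁ * e i + W.a₃) / 2) + W.a₁ * e i + W.a₃) = 0 := by ring
  rw [this]
  fin_cases i <;> simp

/-- The points of order two. -/
def IsTwoRoots.point (h : IsTwoRoots W e) (hΔ : W.Δ ≠ 0) (i : Fin 3) : W.toAffine.Point :=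
  .some _ _ (h.nonsingular hΔ i)

variable [DecidableEq F]

lemma IsTwoRoots.two_nsmul_point (h : IsTwoRoots W e) (hΔ : W.Δ ≠ 0) (i : Fin 3) :
    2 • h.point hΔ i = 0 := by
  rw [two_nsmul]
  refine WeierstrassCurve.Affine.Point.add_self_of_Y_eq ?_
  rw [WeierstrassCurve.Affine.negY]
  ring

lemma IsTwoRoots.eq_zero_or_eq_point (h : IsTwoRoots W e) (hΔ : W.Δ ≠ 0)
    {P : W.toAffine.Point} (hP : 2 • P = 0) : P = 0 ∨ ∃ i, P = h.point hΔ i := by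
  rcases P with _ | ⟨x, y, hxy⟩
  · exact .inl rfl
  right
  rw [two_nsmul, add_eq_zero_iff_eq_neg, WeierstrassCurve.Affine.Point.neg_some] at hP
  have hy : y = W.toAffine.negY x y := by simpa using hP
  rw [WeierstrassCurve.Affine.negY] at hy
  have hy' : y = -(W.a₁ * x + W.a₃) / 2 := by linear_combination hy / 2
  have heq := (h.equation_iff x y).1 hxy.1
  have hx : ∃ i, x = e i := by
    have : (2 * y + W.a₁ * x + W.a₃) = 0 := by linear_combination 2 * hy'
    rw [this] at heq
    simpa [Fin.exists_fin_succ, sub_eq_zero, or_assoc] using heq.symm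
  obtain ⟨i, rfl⟩ := hx
  subst hy'
  exact ⟨i, rfl⟩

/-- Over an algebraically closed field every point is a double. In the coordinate
`Y = y + (a₁ * x + a₃) / 2` the curve is `Y ^ 2 = ∏ (x - e i)`. Write `x₀ - e i = r i ^ 2`, with
signs such that `Y₀ = -r₀ * r₁ * r₂`; the line of slope `-(r₀ + r₁ + r₂)` through
`(x₀, -Y₀)` is then tangent to the curve at a point with `x = x₀ + r₀ * r₁ + r₀ * r₂ + r₁ * r₂`. -/
lemma IsTwoRoots.exists_two_nsmul_eq [IsAlgClosed F] (h : IsTwoRoots W e) (hΔ : W.Δ ≠ 0)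
    (P : W.toAffine.Point) : ∃ Q, 2 • Q = P := by
  rcases P with _ | ⟨x, y, hxy⟩
  · exact ⟨0, nsmul_zero 2⟩
  have hinj := h.injective hΔ
  have heq := (h.equation_iff x y).1 hxy.1
  obtain ⟨r, hr⟩ := IsAlgClosed.exists_pow_nat_eq (x - e 0) two_pos
  obtain ⟨s, hs⟩ := IsAlgClosed.exists_pow_nat_eq (x - e 1) two_pos
  obtain ⟨t, ht⟩ := IsAlgClosed.exists_pow_nat_eq (x - e 2) two_pos
  obtain ⟨r, hr, hy⟩ : ∃ r, r ^ 2 = x - e 0 ∧ 2 * y + W.a₁ * x + W.a₃ = -2 * (r * s * t) := by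
    have : (2 * y + W.a₁ * x + W.a₃) ^ 2 = (-2 * (r * s * t)) ^ 2 := by
      rw [heq, ← hr, ← hs, ← ht]; ring
    rcases sq_eq_sq_iff_eq_or_eq_neg.1 this with h | h
    · exact ⟨r, hr, h⟩
    · exact ⟨-r, by rw [neg_sq, hr], by rw [h]; ring⟩
  have h0 : e 0 = x - r ^ 2 := by rw [hr]; ring
  have h1 : e 1 = x - s ^ 2 := by rw [hs]; ring
  have h2 : e 2 = x - t ^ 2 := by rw [ht]; ring
  have hrs : r + s ≠ 0 := fun h' => absurd (hinj (a₁ := 0) (a₂ := 1) (by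
    rw [h0, h1]; linear_combination (s - r) * h')) (by decide)
  have hrt : r + t ≠ 0 := fun h' => absurd (hinj (a₁ := 0) (a₂ := 2) (by
    rw [h0, h2]; linear_combination (t - r) * h')) (by decide)
  have hst : s + t ≠ 0 := fun h' => absurd (hinj (a₁ := 1) (a₂ := 2) (by
    rw [h1, h2]; linear_combination (t - s) * h')) (by decide)
  obtain ⟨u, hu⟩ : ∃ u, u = x + (r * s + r * t + s * t) := ⟨_, rfl⟩
  obtain ⟨v, hv⟩ : ∃ v, 2 * v + W.a₁ * u + W.a₃ = -2 * ((r + s) * (r + t) * (s + t)) :=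
    ⟨(-2 * ((r + s) * (r + t) * (s + t)) - W.a₁ * u - W.a₃) / 2, by ring⟩
  have hQ : W.toAffine.Nonsingular u v := by
    rw [← WeierstrassCurve.Affine.equation_iff_nonsingular_of_Δ_ne_zero hΔ, h.equation_iff,
      hv, h0, h1, h2, hu]
    ring
  obtain ⟨hb2, hb4, hb6⟩ := h
  simp only [WeierstrassCurve.b₂, WeierstrassCurve.b₄, h0, h1, h2] at hb2 hb4
  have hprod : -2 * ((r + s) * (r + t) * (s + t)) ≠ 0 :=
    mul_ne_zero (by norm_num) (mul_ne_zero (mul_ne_zero hrs hrt) hst)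
  have hne : v ≠ W.toAffine.negY u v := by
    intro h'
    rw [WeierstrassCurve.Affine.negY] at h'
    exact hprod (by linear_combination h' - hv)
  have hslope : W.toAffine.slope u u v v = -(r + s + t) - W.a₁ / 2 := by
    have hden : v - W.toAffine.negY u v = -2 * ((r + s) * (r + t) * (s + t)) := by
      rw [WeierstrassCurve.Affine.negY]; linear_combination hv
    rw [WeierstrassCurve.Affine.slope_of_Y_ne rfl hne, hden, div_eq_iff hprod]
    have ha2 : W.a₂ = -(x - r ^ 2 + (x - s ^ 2) + (x - t ^ 2)) - W.a₁ ^ 2 / 4 := by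
      linear_combination hb2 / 4
    have ha4 : W.a₄ = ((x - r ^ 2) * (x - s ^ 2) + (x - r ^ 2) * (x - t ^ 2) +
        (x - s ^ 2) * (x - t ^ 2)) - W.a₁ * W.a₃ / 2 := by
      linear_combination hb4 / 2
    have hv' : v = (-2 * ((r + s) * (r + t) * (s + t)) - W.a₁ * u - W.a₃) / 2 := by
      linear_combination hv / 2
    rw [ha2, ha4, hv', hu]
    ring
  have hX : W.toAffine.addX u u (W.toAffine.slope u u v v) = x := by
    rw [hslope, WeierstrassCurve.Affine.addX, hu]
    linear_combination - hb2 / 4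
  refine ⟨.some _ _ hQ, ?_⟩
  rw [two_nsmul, WeierstrassCurve.Affine.Point.add_self_of_Y_ne hne]
  rw [WeierstrassCurve.Affine.Point.some.injEq]
  refine ⟨hX, ?_⟩
  rw [WeierstrassCurve.Affine.addY, WeierstrassCurve.Affine.negAddY, hX,
    WeierstrassCurve.Affine.negY, hslope]
  rw [hu] at hv ⊢
  linear_combination (-1/2) * hy - hv / 2

end TwoTorsion

/-! ### Square roots in cyclotomic fields -/

lemma cyclo_mono {m n : ℕ} (h : m ∣ n) : cyclo m ≤ cyclo n := by
  obtain ⟨k, rfl⟩ := h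
  refine IntermediateField.adjoin.mono _ _ _ fun z (hz : z ^ m = 1) => ?_
  rw [Set.mem_ofPred_eq, pow_mul, hz, one_pow]

lemma mem_cyclo {n : ℕ} {z : QBar} (hz : z ^ n = 1) : z ∈ cyclo n :=
  IntermediateField.subset_adjoin _ _ hz

lemma exists_sq_eq_neg_one_mem_cyclo : ∃ i ∈ cyclo 4, i ^ 2 = -1 := by
  obtain ⟨i, hi⟩ := IsAlgClosed.exists_pow_nat_eq (-1 : QBar) two_pos
  refine ⟨i, mem_cyclo ?_, hi⟩
  linear_combination (i ^ 2 - 1) * hi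

lemma exists_sq_eq_two_mem_cyclo : ∃ z ∈ cyclo 8, z ^ 2 = 2 := by
  obtain ⟨w, hw⟩ := IsAlgClosed.exists_pow_nat_eq (-1 : QBar) four_pos
  have hw8 : w ^ 8 = 1 := by linear_combination (w ^ 4 - 1) * hw
  -- `w` is a primitive eighth root of unity, with inverse `-w ^ 3`
  refine ⟨w - w ^ 3, sub_mem (mem_cyclo hw8) (pow_mem (mem_cyclo hw8) 3), ?_⟩
  linear_combination (w ^ 2 - 2) * hw

/-- The quadratic Gauss sum modulo an odd prime `p` is a square root of `±p`. -/
lemma exists_sq_eq_or_eq_neg_mem_cyclo {p : ℕ} (hp : p.Prime) (h2 : p ≠ 2) :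
    ∃ z ∈ cyclo p, z ^ 2 = p ∨ z ^ 2 = -p := by
  have := Fact.mk hp
  obtain ⟨ζ, hζ⟩ := HasEnoughRootsOfUnity.exists_primitiveRoot QBar p
  have hr : ringChar (ZMod p) ≠ 2 := by rwa [ZMod.ringChar_zmod_n]
  set χ := (quadraticChar (ZMod p)).ringHomComp (Int.castRingHom QBar) with hχ
  have hsq := gaussSum_sq (χ := χ)
    (fun h => quadraticChar_ne_one hr
      ((MulChar.ringHomComp_eq_one_iff (RingHom.injective_int _)).1 h))
    ((quadraticChar_isQuadratic (ZMod p)).comp _)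
    (AddChar.zmodChar_primitive_of_primitive_root p hζ)
  have hmem : gaussSum χ (AddChar.zmodChar p hζ.pow_eq_one) ∈ cyclo p := by
    refine sum_mem fun a _ => mul_mem ?_ ?_
    · rw [hχ, MulChar.ringHomComp_apply]
      exact intCast_mem _ _
    · rw [AddChar.zmodChar_apply]
      exact pow_mem (mem_cyclo hζ.pow_eq_one) _
  refine ⟨_, hmem, ?_⟩
  rw [hsq, ZMod.card, hχ, MulChar.ringHomComp_apply]
  rcases quadraticChar_isQuadratic (ZMod p) (-1) with h | h | h
  · exact absurd (quadraticChar_eq_zero_iff.1 h) (by simp)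
  · left; simp [h]
  · right; simp [h]

lemma exists_sq_eq_natCast_mem_cyclo (n : ℕ) : ∃ z ∈ cyclo (4 * n), z ^ 2 = n := by
  induction n using induction_on_primes with
  | zero => exact ⟨0, zero_mem _, by simp⟩
  | one => exact ⟨1, one_mem _, by simp⟩
  | prime_mul p a hp ih =>
    obtain ⟨z, hz, hza⟩ := ih
    obtain ⟨y, hy, hyp⟩ : ∃ y ∈ cyclo (4 * (p * a)), y ^ 2 = p := by
      rcases eq_or_ne p 2 with rfl | h2
      · obtain ⟨y, hy, h⟩ := exists_sq_eq_two_mem_cyclo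
        exact ⟨y, cyclo_mono ⟨a, by ring⟩ hy, by simpa using h⟩
      · obtain ⟨y, hy, h⟩ := exists_sq_eq_or_eq_neg_mem_cyclo hp h2
        have hy' : y ∈ cyclo (4 * (p * a)) := cyclo_mono ⟨4 * a, by ring⟩ hy
        rcases h with h | h
        · exact ⟨y, hy', h⟩
        · obtain ⟨i, hi, hi2⟩ := exists_sq_eq_neg_one_mem_cyclo
          exact ⟨i * y, mul_mem (cyclo_mono ⟨p * a, rfl⟩ hi) hy', by rw [mul_pow, h, hi2]; ring⟩
    refine ⟨y * z, mul_mem hy (cyclo_mono ⟨p, by ring⟩ hz), ?_⟩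
    rw [mul_pow, hyp, hza, Nat.cast_mul]

lemma mem_cyclo_of_sq_eq_intCast {D : ℤ} {z : QBar} (hz : z ^ 2 = D) :
    z ∈ cyclo (4 * D.natAbs) := by
  obtain ⟨y, hy, h⟩ := exists_sq_eq_natCast_mem_cyclo D.natAbs
  obtain ⟨i, hi, hi2⟩ := exists_sq_eq_neg_one_mem_cyclo
  have hi' : i ∈ cyclo (4 * D.natAbs) := cyclo_mono ⟨_, rfl⟩ hi
  obtain ⟨w, hw, hwD⟩ : ∃ w ∈ cyclo (4 * D.natAbs), w ^ 2 = D := by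
    rcases Int.natAbs_eq D with hD | hD
    · refine ⟨y, hy, ?_⟩
      rw [h]
      conv_rhs => rw [hD]
      simp
    · refine ⟨i * y, mul_mem hi' hy, ?_⟩
      rw [mul_pow, h, hi2]
      conv_rhs => rw [hD]
      simp
  rcases sq_eq_sq_iff_eq_or_eq_neg.1 (hz.trans hwD.symm) with rfl | rfl
  · exact hw
  · exact neg_mem hw

/-! ### Cyclotomic fields are abelian -/

lemma cyclo_two : cyclo 2 = ⊥ := by
  refine eq_bot_iff.2 (IntermediateField.adjoin_le_iff.2 fun z (hz : z ^ 2 = 1) => ?_)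
  rcases sq_eq_one_iff.1 hz with rfl | rfl
  · exact one_mem _
  · exact neg_mem (one_mem _)

lemma cyclo_le_qAb {n : ℕ} (hn : 0 < n) : cyclo n ≤ qAb := by
  have : NeZero n := ⟨hn.ne'⟩
  have : IsCyclotomicExtension {n} ℚ (cyclo n) := by
    have := IntermediateField.isCyclotomicExtension_adjoin_of_exists_isPrimitiveRoot {n} ℚ QBar
      fun k hk _ => by
        obtain rfl := hk
        exact HasEnoughRootsOfUnity.exists_primitiveRoot QBar _
    have hset : {b : QBar | ∃ k ∈ ({n} : Set ℕ), k ≠ 0 ∧ b ^ k = 1} = {z : QBar | z ^ n = 1} := by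
      ext z
      simp [hn.ne']
    rwa [hset] at this
  exact le_iSup₂_of_le (cyclo n) (IsCyclotomicExtension.isAbelianGalois {n} ℚ _) le_rfl

lemma commutator_apply_of_mem_cyclo {n : ℕ} (hn : 0 < n) (σ τ : GQ) {x : QBar}
    (hx : x ∈ cyclo n) : (τ * σ * τ⁻¹ * σ⁻¹) x = x := by
  have : NeZero n := ⟨hn.ne'⟩
  have hcomm : ∀ z : QBar, z ^ n = 1 → σ (τ z) = τ (σ z) := fun z hz => by
    obtain ⟨a, ha⟩ := map_rootsOfUnity_eq_pow_self σ (rootsOfUnity.mkOfPowEq z hz)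
    obtain ⟨b, hb⟩ := map_rootsOfUnity_eq_pow_self τ (rootsOfUnity.mkOfPowEq z hz)
    simp only [rootsOfUnity.coe_mkOfPowEq] at ha hb
    rw [ha, hb, map_pow, map_pow, ha, hb, ← pow_mul, ← pow_mul, mul_comm]
  induction hx using IntermediateField.adjoin_induction with
  | mem z hz =>
    have hw : (τ⁻¹ (σ⁻¹ z)) ^ n = 1 := by
      rw [← map_pow, ← map_pow, show z ^ n = 1 from hz, map_one, map_one]
    simp only [AlgEquiv.mul_apply]
    rw [← hcomm _ hw, ← AlgEquiv.mul_apply τ, mul_inv_cancel, AlgEquiv.one_apply,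
      ← AlgEquiv.mul_apply σ, mul_inv_cancel, AlgEquiv.one_apply]
  | algebraMap q => simp
  | add a b _ _ ha hb => rw [map_add, ha, hb]
  | mul a b _ _ ha hb => rw [map_mul, ha, hb]
  | inv a _ ha => rw [map_inv₀, ha]

instance : Algebra.IsAlgebraic ℚ QBar := AlgebraicClosure.isAlgebraic ℚ

instance : IsAlgClosure ℚ QBar := ⟨inferInstance, inferInstance⟩

instance : IsGalois ℚ QBar where
  to_normal := IsAlgClosure.normal ℚ QBar

/-! ### The two-division field -/

section TwoDivision

variable {E : WeierstrassCurve ℚ} {e : Fin 3 → QBar}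

lemma discr_baseChange_ne_zero (E : WeierstrassCurve ℚ) [E.IsElliptic] :
    (E.baseChange QBar).Δ ≠ 0 := by
  rw [WeierstrassCurve.baseChange, WeierstrassCurve.map_Δ]
  exact (map_ne_zero _).2 E.isUnit_Δ.ne_zero

/-- The Galois group permutes the roots of the two-torsion cubic. -/
lemma IsTwoRoots.exists_perm (h : IsTwoRoots (E.baseChange QBar) e)
    (hΔ : (E.baseChange QBar).Δ ≠ 0) (σ : GQ) :
    ∃ s : Equiv.Perm (Fin 3), ∀ i, σ (e i) = e (s i) := by
  have hroot : ∀ i, ∃ j, σ (e i) = e j := fun i => by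
    have := congrArg σ ((h.cubic_eq_zero_iff (e i)).2 ⟨i, rfl⟩)
    refine (h.cubic_eq_zero_iff _).1 ?_
    simpa [WeierstrassCurve.baseChange, WeierstrassCurve.map_b₂, WeierstrassCurve.map_b₄,
      WeierstrassCurve.map_b₆, map_ofNat σ] using this
  choose s hs using hroot
  have hinj : Function.Injective s := fun i j hij =>
    h.injective hΔ (σ.injective (by rw [hs, hs, hij]))
  exact ⟨Equiv.ofBijective s (Finite.injective_iff_bijective.1 hinj), hs⟩

lemma apply_vandermonde {σ : GQ} {s : Equiv.Perm (Fin 3)} (hs : ∀ i, σ (e i) = e (s i)) :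
    σ (vandermonde e) = ((Equiv.Perm.sign s : ℤ) : QBar) * vandermonde e := by
  simp only [vandermonde, map_mul, map_sub, hs]
  clear hs
  revert s
  have hdecomp : ∀ s : Equiv.Perm (Fin 3),
      (s 0 = 0 ∧ s 1 = 1 ∧ s 2 = 2 ∧ Equiv.Perm.sign s = 1) ∨
      (s 0 = 1 ∧ s 1 = 2 ∧ s 2 = 0 ∧ Equiv.Perm.sign s = 1) ∨
      (s 0 = 2 ∧ s 1 = 0 ∧ s 2 = 1 ∧ Equiv.Perm.sign s = 1) ∨
      (s 0 = 1 ∧ s 1 = 0 ∧ s 2 = 2 ∧ Equiv.Perm.sign s = -1) ∨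
      (s 0 = 2 ∧ s 1 = 1 ∧ s 2 = 0 ∧ Equiv.Perm.sign s = -1) ∨
      (s 0 = 0 ∧ s 1 = 2 ∧ s 2 = 1 ∧ Equiv.Perm.sign s = -1) := by decide
  intro s
  rcases hdecomp s with ⟨h0, h1, h2, h⟩ | ⟨h0, h1, h2, h⟩ | ⟨h0, h1, h2, h⟩ | ⟨h0, h1, h2, h⟩ |
    ⟨h0, h1, h2, h⟩ | ⟨h0, h1, h2, h⟩ <;> rw [h0, h1, h2, h] <;> push_cast <;> ring

/-- In the symmetric group on three letters, conjugation by an odd permutation inverts the even ones,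
which have order dividing three. -/
lemma commutator_eq_of_sign : ∀ s t : Equiv.Perm (Fin 3), Equiv.Perm.sign s = 1 →
    Equiv.Perm.sign t = -1 → t * s * t⁻¹ * s⁻¹ = s := by
  decide

lemma mem_ker_rhoMod_iff {n : ℕ} {σ : GQ} :
    σ ∈ (rhoMod E n).ker ↔ ∀ P ∈ tors E n, galPoint E σ P = P := by
  rw [MonoidHom.mem_ker, Units.ext_iff, DFunLike.ext_iff]
  constructor
  · intro h P hP
    exact congrArg Subtype.val (h ⟨P, hP⟩)
  · intro h P
    exact Subtype.ext (h P.1 P.2)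

lemma galPoint_point (h : IsTwoRoots (E.baseChange QBar) e) (hΔ : (E.baseChange QBar).Δ ≠ 0)
    {σ : GQ} {i j : Fin 3} (hij : σ (e i) = e j) :
    galPoint E σ (h.point hΔ i) = h.point hΔ j := by
  rw [galPoint, IsTwoRoots.point, WeierstrassCurve.Affine.Point.map_some, IsTwoRoots.point,
    WeierstrassCurve.Affine.Point.some.injEq]
  refine ⟨hij, ?_⟩
  rw [← hij]
  simp [WeierstrassCurve.baseChange, WeierstrassCurve.map, map_ofNat σ]

lemma point_injective (h : IsTwoRoots (E.baseChange QBar) e) (hΔ : (E.baseChange QBar).Δ ≠ 0) :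
    Function.Injective (h.point hΔ) := fun i j hij => by
  rw [IsTwoRoots.point, IsTwoRoots.point, WeierstrassCurve.Affine.Point.some.injEq] at hij
  exact h.injective hΔ hij.1

lemma mem_ker_rhoMod_two_iff (h : IsTwoRoots (E.baseChange QBar) e)
    (hΔ : (E.baseChange QBar).Δ ≠ 0) {σ : GQ} :
    σ ∈ (rhoMod E 2).ker ↔ ∀ i, σ (e i) = e i := by
  rw [mem_ker_rhoMod_iff]
  constructor
  · intro hσ i
    obtain ⟨s, hs⟩ := h.exists_perm hΔ σ
    have := hσ (h.point hΔ i)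
      (AddSubgroup.torsionBy.nsmul_iff.2 (h.two_nsmul_point hΔ i))
    rw [galPoint_point h hΔ (hs i)] at this
    rw [hs, point_injective h hΔ this]
  · intro hσ P hP
    rcases h.eq_zero_or_eq_point hΔ (AddSubgroup.torsionBy.nsmul_iff.1 hP) with rfl | ⟨i, rfl⟩
    · exact map_zero _
    · exact galPoint_point h hΔ (hσ i)

/-- `√Δ = 4 ∏_{i < j} (e i - e j)` lies in the two-division field. -/
lemma vandermonde_mem_divField (h : IsTwoRoots (E.baseChange QBar) e)
    (hΔ : (E.baseChange QBar).Δ ≠ 0) : vandermonde e ∈ divField E 2 := by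
  rintro ⟨σ, hσ⟩
  have := (mem_ker_rhoMod_two_iff h hΔ).1 hσ
  change σ (vandermonde e) = _
  simp only [vandermonde, map_mul, map_sub, this]

lemma algebraMap_discr (h : IsTwoRoots (E.baseChange QBar) e) :
    algebraMap ℚ QBar E.Δ = (4 * vandermonde e) ^ 2 := by
  rw [← h.discr_eq]
  exact (E.map_Δ _).symm

/-- An element of the two-division field which lies in a cyclotomic field is fixed by every `σ`
fixing `√Δ`, if `Δ` is not a square: such a `σ` induces an even permutation of the
roots, some `τ` induces an odd one, and in the symmetric group on three letters `σ` agrees with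
its commutator with `τ`, which acts trivially on cyclotomic fields. -/
lemma apply_eq_self_of_mem_divField_of_mem_cyclo [E.IsElliptic] {n : ℕ} (hn : 0 < n)
    (h : IsTwoRoots (E.baseChange QBar) e) (hsq : ¬ IsSquare E.Δ) {x : QBar}
    (hx : x ∈ divField E 2) (hx' : x ∈ cyclo n) {σ : GQ}
    (hσ : σ (vandermonde e) = vandermonde e) : σ x = x := by
  have hΔ := discr_baseChange_ne_zero E
  have hv : vandermonde e ≠ 0 := fun h0 => hΔ (by rw [h.discr_eq, h0]; ring)
  have hsign : ∀ {ρ : GQ} {s : Equiv.Perm (Fin 3)}, (∀ i, ρ (e i) = e (s i)) →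
      (ρ (vandermonde e) = vandermonde e ↔ Equiv.Perm.sign s = 1) := by
    intro ρ s hs
    rw [apply_vandermonde hs]
    rcases Int.units_eq_one_or (Equiv.Perm.sign s) with h1 | h1 <;> rw [h1]
    · simp
    · simpa [neg_eq_self] using hv
  obtain ⟨τ, hτ⟩ : ∃ τ : GQ, τ (vandermonde e) ≠ vandermonde e := by
    by_contra! hfix
    obtain ⟨q, hq⟩ := (InfiniteGalois.mem_range_algebraMap_iff_fixed _).2 hfix
    refine hsq ⟨4 * q, (algebraMap ℚ QBar).injective ?_⟩
    rw [algebraMap_discr h, ← hq]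
    simp
    ring
  obtain ⟨s, hs⟩ := h.exists_perm hΔ σ
  obtain ⟨t, ht⟩ := h.exists_perm hΔ τ
  have hs1 := (hsign hs).1 hσ
  have ht1 := (Int.units_eq_one_or (Equiv.Perm.sign t)).resolve_left fun h1 => hτ ((hsign ht).2 h1)
  have hinv : ∀ {ρ : GQ} {r : Equiv.Perm (Fin 3)}, (∀ i, ρ (e i) = e (r i)) →
      ∀ i, ρ⁻¹ (e i) = e (r⁻¹ i) := by
    intro ρ r hr i
    apply ρ.injective
    rw [← AlgEquiv.mul_apply, mul_inv_cancel, hr, Equiv.Perm.coe_inv, Equiv.apply_symm_apply,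
      AlgEquiv.one_apply]
  set c := τ * σ * τ⁻¹ * σ⁻¹ with hc
  have hcs : ∀ i, c (e i) = e (s i) := fun i => by
    conv_rhs => rw [← commutator_eq_of_sign s t hs1 ht1]
    simp only [hc, AlgEquiv.mul_apply, hinv hs, hinv ht, hs, ht, Equiv.Perm.mul_apply]
  have hker : c⁻¹ * σ ∈ (rhoMod E 2).ker := (mem_ker_rhoMod_two_iff h hΔ).2 fun i => by
    rw [AlgEquiv.mul_apply, hs, hinv hcs, Equiv.Perm.coe_inv, Equiv.symm_apply_apply]
  have hfix : (c⁻¹ * σ) x = x := hx ⟨_, hker⟩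
  calc σ x = c ((c⁻¹ * σ) x) := by rw [← AlgEquiv.mul_apply, mul_inv_cancel_left]
    _ = x := by rw [hfix, hc, commutator_apply_of_mem_cyclo hn σ τ hx']

end TwoDivision

/-! ### The quadratic field of the discriminant -/

lemma sqrtField_eq_adjoin {q : ℚ} {z : QBar} (hz : z ^ 2 = algebraMap ℚ QBar q) :
    sqrtField q = IntermediateField.adjoin ℚ {z} := by
  refine le_antisymm (IntermediateField.adjoin_le_iff.2 fun y (hy : y ^ 2 = _) => ?_)
    (IntermediateField.adjoin_simple_le_iff.2 (IntermediateField.subset_adjoin _ _ hz))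
  have hmem := IntermediateField.mem_adjoin_simple_self ℚ z
  rcases sq_eq_sq_iff_eq_or_eq_neg.1 (hy.trans hz.symm) with rfl | rfl
  · exact hmem
  · exact neg_mem hmem

lemma sqrtField_mul_sq {q u : ℚ} (hu : u ≠ 0) : sqrtField (u ^ 2 * q) = sqrtField q := by
  obtain ⟨z, hz⟩ := IsAlgClosed.exists_pow_nat_eq (algebraMap ℚ QBar q) two_pos
  have huz : (algebraMap ℚ QBar u * z) ^ 2 = algebraMap ℚ QBar (u ^ 2 * q) := by
    rw [mul_pow, hz, map_mul, map_pow]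
  have hu' : algebraMap ℚ QBar u ≠ 0 := by simpa using hu
  rw [sqrtField_eq_adjoin hz, sqrtField_eq_adjoin huz]
  refine le_antisymm (IntermediateField.adjoin_simple_le_iff.2 ?_)
    (IntermediateField.adjoin_simple_le_iff.2 ?_)
  · exact mul_mem (IntermediateField.algebraMap_mem _ _)
      (IntermediateField.mem_adjoin_simple_self ℚ z)
  · have := mul_mem (inv_mem (IntermediateField.algebraMap_mem
      (IntermediateField.adjoin ℚ {algebraMap ℚ QBar u * z}) u))
      (IntermediateField.mem_adjoin_simple_self ℚ (algebraMap ℚ QBar u * z))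
    rwa [inv_mul_cancel_left₀ hu'] at this

lemma finrank_sqrtField {q : ℚ} (hq : ¬ IsSquare q) : Module.finrank ℚ (sqrtField q) = 2 := by
  obtain ⟨z, hz⟩ := IsAlgClosed.exists_pow_nat_eq (algebraMap ℚ QBar q) two_pos
  have hmin : minpoly ℚ z = Polynomial.X ^ 2 - Polynomial.C q := by
    refine (minpoly.eq_of_irreducible_of_monic ?_ (by simp [hz])
      (Polynomial.monic_X_pow_sub_C q two_ne_zero)).symm
    rw [X_pow_sub_C_irreducible_iff_of_prime Nat.prime_two]
    rintro b rfl
    exact hq ⟨b, sq b⟩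
  rw [sqrtField_eq_adjoin hz, IntermediateField.adjoin.finrank (Algebra.IsIntegral.isIntegral z),
    hmin, Polynomial.natDegree_X_pow_sub_C]

lemma galIso_bot_sqrtField {q : ℚ} (hq : ¬ IsSquare q) :
    GalIso ⊥ (sqrtField q) (Multiplicative (ZMod 2)) := by
  refine ⟨bot_le, ?_⟩
  set K := IntermediateField.extendScalars (bot_le : (⊥ : IntermediateField ℚ QBar) ≤ sqrtField q)
  have hrank : Module.finrank (⊥ : IntermediateField ℚ QBar) K = 2 :=
    (IntermediateField.relfinrank_eq_finrank_of_le bot_le).symm.trans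
      ((IntermediateField.relfinrank_bot_left _).trans (finrank_sqrtField hq))
  have : Algebra.IsQuadraticExtension (⊥ : IntermediateField ℚ QBar) K := ⟨hrank⟩
  have : IsGalois (⊥ : IntermediateField ℚ QBar) K := {}
  have : FiniteDimensional (⊥ : IntermediateField ℚ QBar) K :=
    Module.finite_of_finrank_pos (by rw [hrank]; norm_num)
  have hcard := IsGalois.card_aut_eq_finrank (⊥ : IntermediateField ℚ QBar) K
  rw [hrank] at hcard
  exact ⟨mulEquivOfPrimeCardEq (p := 2) hcard (by simp)⟩

lemma divField_inf_cyclo {E : WeierstrassCurve ℚ} [E.IsElliptic] (hsq : ¬ IsSquare E.Δ) {n : ℕ}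
    (hn : 0 < n) (hle : sqrtField E.Δ ≤ cyclo n) : divField E 2 ⊓ cyclo n = sqrtField E.Δ := by
  obtain ⟨e, h⟩ := exists_isTwoRoots (E.baseChange QBar)
  have hΔ := discr_baseChange_ne_zero E
  have hsqrt := sqrtField_eq_adjoin (algebraMap_discr h).symm
  refine le_antisymm ?_ (le_inf ?_ hle)
  · rintro x ⟨hx, hx'⟩
    rw [← InfiniteGalois.fixedField_fixingSubgroup (sqrtField E.Δ)]
    rintro ⟨σ, hσ⟩
    refine apply_eq_self_of_mem_divField_of_mem_cyclo hn h hsq hx hx' ?_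
    have h4 := (IntermediateField.mem_fixingSubgroup_iff _ _).1 hσ (4 * vandermonde e)
      (hsqrt ▸ IntermediateField.mem_adjoin_simple_self ℚ _)
    simpa [map_ofNat σ] using h4
  · rw [hsqrt]
    refine IntermediateField.adjoin_simple_le_iff.2 ?_
    exact mul_mem (ofNat_mem _ 4) (vandermonde_mem_divField h hΔ)

/-! ### Swapping two points of order two -/

lemma sign_eq_neg_one_of_swap : ∀ (s : Equiv.Perm (Fin 3)) (i j : Fin 3), i ≠ j → s i = j →
    s j = i → Equiv.Perm.sign s = -1 := by
  decide

/-- If the discriminant is a square, the Galois group acts on the points of order two through even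
permutations, so no element of it interchanges two of them. -/
lemma not_swap_of_isSquare {E : WeierstrassCurve ℚ} [E.IsElliptic] (hsq : IsSquare E.Δ) {σ : GQ}
    {P Q : Pts E} (hP : 2 • P = 0) (hPQ : P ≠ Q) (hσP : galPoint E σ P = Q)
    (hσQ : galPoint E σ Q = P) : False := by
  obtain ⟨e, h⟩ := exists_isTwoRoots (E.baseChange QBar)
  have hΔ := discr_baseChange_ne_zero E
  have hv : vandermonde e ≠ 0 := fun h0 => hΔ (by rw [h.discr_eq, h0]; ring)
  obtain ⟨s, hs⟩ := h.exists_perm hΔ σ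
  rcases h.eq_zero_or_eq_point hΔ hP with rfl | ⟨i, rfl⟩
  · exact hPQ ((map_zero _).symm.trans hσP)
  rw [galPoint_point h hΔ (hs i)] at hσP
  subst hσP
  rw [galPoint_point h hΔ (hs (s i))] at hσQ
  have hsign := sign_eq_neg_one_of_swap s i (s i) (fun hi => hPQ (congrArg _ hi)) rfl
    (point_injective h hΔ hσQ)
  have hneg : σ (vandermonde e) = -vandermonde e := by
    rw [apply_vandermonde hs, hsign]
    simp
  obtain ⟨q, hq⟩ := hsq
  have hq' : (4 * vandermonde e) ^ 2 = (algebraMap ℚ QBar q) ^ 2 := by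
    rw [← algebraMap_discr h, hq, map_mul, sq]
  have hfix : σ (4 * vandermonde e) = 4 * vandermonde e := by
    rcases sq_eq_sq_iff_eq_or_eq_neg.1 hq' with h' | h' <;> rw [h'] <;> simp
  rw [map_mul, map_ofNat σ, hneg] at hfix
  have h4 : (4 : QBar) ≠ 0 := by norm_num
  exact hv (neg_eq_self.1 (mul_left_cancel₀ h4 hfix))

/-! ### Compatible bases of the two-power torsion -/

section Basis

variable {A : Type*} [AddCommGroup A]

/-- A pair of sequences `P`, `Q` with `2 • P (k + 1) = P k` and `2 • Q (k + 1) = Q k` such that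
`P 1` and `Q 1` form a basis of the two-torsion of `A`. -/
structure IsTwoPowerBasis (P Q : ℕ → A) : Prop where
  left_zero : P 0 = 0
  right_zero : Q 0 = 0
  left_succ : ∀ k, 2 • P (k + 1) = P k
  right_succ : ∀ k, 2 • Q (k + 1) = Q k
  span_one : ∀ R : A, 2 • R = 0 → ∃ a b : ℤ, R = a • P 1 + b • Q 1
  indep_one : ∀ a b : ℤ, a • P 1 + b • Q 1 = 0 → 2 ∣ a ∧ 2 ∣ b

/-- The symmetry relation "`S` is the image of `R` under interchanging `p` and `q`". -/
def IsSwap (p q R S : A) : Prop := ∃ a b : ℤ, R = a • p + b • q ∧ S = b • p + a • q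

lemma pow_two_nsmul_of_succ {P : ℕ → A} (h : ∀ k, 2 • P (k + 1) = P k) (k m : ℕ) :
    2 ^ k • P (k + m) = P m := by
  induction k with
  | zero => simp
  | succ k ih => rw [pow_succ, mul_smul, show k + 1 + m = k + m + 1 by ring, h, ih]

namespace IsTwoPowerBasis

variable {P Q : ℕ → A} (h : IsTwoPowerBasis P Q)
include h

lemma span (k : ℕ) : ∀ R : A, 2 ^ k • R = 0 → ∃ a b : ℤ, R = a • P k + b • Q k := by
  induction k with
  | zero => exact fun R hR => ⟨0, 0, by simpa using hR⟩
  | succ k ih =>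
    intro R hR
    obtain ⟨a, b, hab⟩ := h.span_one (2 ^ k • R) (by rw [← mul_smul, ← pow_succ', hR])
    obtain ⟨c, d, hcd⟩ := ih (R - (a • P (k + 1) + b • Q (k + 1))) (by
      rw [smul_sub, smul_add, smul_comm _ a, smul_comm _ b, pow_two_nsmul_of_succ h.left_succ,
        pow_two_nsmul_of_succ h.right_succ, hab, sub_self])
    refine ⟨a + c * 2, b + d * 2, ?_⟩
    rw [← h.left_succ k, ← h.right_succ k, sub_eq_iff_eq_add] at hcd
    rw [hcd]
    module

lemma indep (k : ℕ) : ∀ a b : ℤ, a • P k + b • Q k = 0 → 2 ^ k ∣ a ∧ 2 ^ k ∣ b := by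
  induction k with
  | zero => simp
  | succ k ih =>
    intro a b hab
    obtain ⟨⟨a, rfl⟩, ⟨b, rfl⟩⟩ := ih a b (by
      rw [← h.left_succ, ← h.right_succ, smul_comm, smul_comm b, ← smul_add, hab, smul_zero])
    have hP := pow_two_nsmul_of_succ h.left_succ k 1
    have hQ := pow_two_nsmul_of_succ h.right_succ k 1
    obtain ⟨⟨c, rfl⟩, ⟨d, rfl⟩⟩ := h.indep_one a b (by
      rw [← hP, ← hQ, ← hab]
      module)
    exact ⟨⟨c, by ring⟩, ⟨d, by ring⟩⟩

lemma smul_left_eq_zero {k : ℕ} {a : ℤ} (ha : 2 ^ k ∣ a) : a • P k = 0 := by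
  obtain ⟨a, rfl⟩ := ha
  have hP := pow_two_nsmul_of_succ h.left_succ k 0
  rw [add_zero, h.left_zero] at hP
  rw [mul_comm, mul_smul, show (2 ^ k : ℤ) • P k = 2 ^ k • P k by module, hP, smul_zero]

lemma symm : IsTwoPowerBasis Q P where
  left_zero := h.right_zero
  right_zero := h.left_zero
  left_succ := h.right_succ
  right_succ := h.left_succ
  span_one R hR := by
    obtain ⟨a, b, hab⟩ := h.span_one R hR
    exact ⟨b, a, by rw [hab, add_comm]⟩
  indep_one a b hab := (h.indep_one b a (by rw [← hab, add_comm])).symm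

lemma two_nsmul_left_one : 2 • P 1 = 0 := by rw [h.left_succ 0, h.left_zero]

lemma two_nsmul_smul_add_smul_one (a b : ℤ) : 2 • (a • P 1 + b • Q 1) = 0 := by
  rw [smul_add, smul_comm, h.two_nsmul_left_one, smul_comm, h.symm.two_nsmul_left_one, smul_zero,
    smul_zero, add_zero]

lemma left_one_ne_right_one : P 1 ≠ Q 1 := fun hPQ => by
  have := (h.indep_one 1 (-1) (by rw [hPQ]; module)).1
  norm_num at this

lemma isSwap_unique {k : ℕ} {R S S' : A} (hS : IsSwap (P k) (Q k) R S)
    (hS' : IsSwap (P k) (Q k) R S') : S = S' := by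
  obtain ⟨a, b, hR, rfl⟩ := hS
  obtain ⟨c, d, hR', rfl⟩ := hS'
  obtain ⟨hac, hbd⟩ := h.indep k (a - c) (b - d) (by
    rw [sub_smul, sub_smul, sub_add_sub_comm, ← hR, ← hR', sub_self])
  have h1 := h.symm.smul_left_eq_zero hac
  have h2 := h.smul_left_eq_zero hbd
  rw [sub_smul, sub_eq_zero] at h1 h2
  rw [h1, h2]

end IsTwoPowerBasis

lemma IsSwap.symm {p q R S : A} (h : IsSwap p q R S) : IsSwap p q S R := by
  obtain ⟨a, b, h1, h2⟩ := h
  exact ⟨b, a, h2, h1⟩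

lemma IsSwap.add {p q R S R' S' : A} (h : IsSwap p q R S) (h' : IsSwap p q R' S') :
    IsSwap p q (R + R') (S + S') := by
  obtain ⟨a, b, rfl, rfl⟩ := h
  obtain ⟨a', b', rfl, rfl⟩ := h'
  exact ⟨a + a', b + b', by module, by module⟩

lemma isSwap_self (p q : A) : IsSwap p q p q := ⟨1, 0, by simp, by simp⟩

lemma IsSwap.two_nsmul {p q R S : A} (h : IsSwap p q R S) :
    IsSwap (2 • p) (2 • q) (2 • R) (2 • S) := by
  obtain ⟨a, b, rfl, rfl⟩ := h
  exact ⟨a, b, by module, by module⟩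

lemma zsmul_eq_emod_two_zsmul {p : A} (hp : 2 • p = 0) (a : ℤ) : a • p = (a % 2) • p := by
  conv_lhs => rw [← Int.emod_add_mul_ediv a 2, add_smul, mul_comm, mul_smul]
  rw [show (2 : ℤ) • p = 2 • p by module, hp, smul_zero, add_zero]

/-- A symmetric additive functional relation is the graph of an automorphism. -/
lemma exists_automorphism_of_rel (r : A → A → Prop) (total : ∀ x, ∃ y, r x y)
    (unique : ∀ {x y y'}, r x y → r x y' → y = y') (symm : ∀ {x y}, r x y → r y x)
    (add : ∀ {x y x' y'}, r x y → r x' y' → r (x + x') (y + y')) :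
    ∃ u : (AddMonoid.End A)ˣ, ∀ x, r x (u.1 x) := by
  choose f hf using total
  let g : AddMonoid.End A := AddMonoidHom.mk' f fun x y => unique (hf _) (add (hf x) (hf y))
  have hg : g * g = 1 := AddMonoidHom.ext fun x => unique (hf (f x)) (symm (hf x))
  exact ⟨⟨g, g, hg, hg⟩, hf⟩

end Basis

lemma mem_tate_two_of_zero {E : WeierstrassCurve ℚ} {P : ℕ → Pts E} (h0 : P 0 = 0)
    (h : ∀ k, 2 • P (k + 1) = P k) : P ∈ tate E 2 := fun k => by
  refine ⟨AddSubgroup.torsionBy.nsmul_iff.2 ?_, h k⟩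
  have := pow_two_nsmul_of_succ h k 0
  rwa [add_zero, h0] at this

/-- The two-power torsion of an elliptic curve over `ℚ̄` has a compatible basis: there are three
points of order two, the third being the sum of the others, and every point is a double. -/
lemma exists_isTwoPowerBasis (E : WeierstrassCurve ℚ) [E.IsElliptic] :
    ∃ P Q : ℕ → Pts E, IsTwoPowerBasis P Q := by
  obtain ⟨e, h⟩ := exists_isTwoRoots (E.baseChange QBar)
  have hΔ := discr_baseChange_ne_zero E
  -- `seq p` is the sequence `0, p, p / 2, p / 4, …` for a fixed choice of halves
  choose half hhalf using fun P : Pts E => h.exists_two_nsmul_eq hΔ P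
  let seq (p : Pts E) (k : ℕ) : Pts E := Nat.casesOn k 0 fun k => half^[k] p
  have hseq : ∀ p : Pts E, 2 • p = 0 → ∀ k, 2 • seq p (k + 1) = seq p k := by
    rintro p hp (_ | k)
    · exact hp
    · change 2 • half^[k + 1] p = half^[k] p
      rw [Function.iterate_succ_apply', hhalf]
  set p : Fin 3 → Pts E := h.point hΔ
  have hp2 : ∀ i, 2 • p i = 0 := h.two_nsmul_point hΔ
  have hp0 : ∀ i, p i ≠ 0 := fun i => WeierstrassCurve.Affine.Point.some_ne_zero _
  have hinj : Function.Injective p := point_injective h hΔ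
  have hneg : ∀ i, -p i = p i := fun i => by
    rw [neg_eq_iff_add_eq_zero, ← two_nsmul, hp2]
  have hsum0 : p 0 + p 1 ≠ 0 := fun h0 => by
    rw [add_eq_zero_iff_eq_neg, hneg] at h0
    exact absurd (hinj h0) (by decide)
  have hsum : p 0 + p 1 = p 2 := by
    rcases h.eq_zero_or_eq_point hΔ (P := p 0 + p 1) (by rw [smul_add, hp2, hp2, add_zero]) with
      h0 | ⟨i, hi⟩
    · exact absurd h0 hsum0
    · fin_cases i
      · exact absurd (add_eq_left.1 hi) (hp0 1)
      · exact absurd (add_eq_right.1 hi) (hp0 0)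
      · exact hi
  refine ⟨seq (p 0), seq (p 1), rfl, rfl, hseq _ (hp2 0), hseq _ (hp2 1), fun R hR => ?_,
    fun a b hab => ?_⟩
  · rcases h.eq_zero_or_eq_point hΔ hR with rfl | ⟨i, rfl⟩
    · exact ⟨0, 0, by simp⟩
    · fin_cases i
      · exact ⟨1, 0, by simp [seq, p]⟩
      · exact ⟨0, 1, by simp [seq, p]⟩
      · exact ⟨1, 1, by simpa [seq] using hsum.symm⟩
  · change a • p 0 + b • p 1 = 0 at hab
    rw [zsmul_eq_emod_two_zsmul (hp2 0) a, zsmul_eq_emod_two_zsmul (hp2 1) b] at hab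
    rw [Int.dvd_iff_emod_eq_zero, Int.dvd_iff_emod_eq_zero]
    rcases Int.emod_two_eq_zero_or_one a with ha | ha <;>
      rcases Int.emod_two_eq_zero_or_one b with hb | hb <;> rw [ha, hb] at hab ⊢ <;>
      simp [hp0, hsum0] at hab ⊢

lemma not_surjective_rhoMod_two {E : WeierstrassCurve ℚ} [E.IsElliptic] (hsq : IsSquare E.Δ) :
    ¬ Function.Surjective (rhoMod E 2) := by
  obtain ⟨P, Q, h⟩ := exists_isTwoPowerBasis E
  have hP := h.two_nsmul_left_one
  have hQ := h.symm.two_nsmul_left_one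
  obtain ⟨u, hu⟩ := exists_automorphism_of_rel (A := tors E 2)
    (fun R S => IsSwap (P 1) (Q 1) R.1 S.1)
    (fun R => by
      obtain ⟨a, b, hab⟩ := h.span_one R.1 (AddSubgroup.torsionBy.nsmul_iff.1 R.2)
      exact ⟨⟨b • P 1 + a • Q 1, AddSubgroup.torsionBy.nsmul_iff.2
        (h.two_nsmul_smul_add_smul_one b a)⟩, a, b, hab, rfl⟩)
    (fun h1 h2 => Subtype.ext (h.isSwap_unique h1 h2)) IsSwap.symm IsSwap.add
  intro hsurj
  obtain ⟨σ, rfl⟩ := hsurj u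
  have h1 := hu ⟨P 1, AddSubgroup.torsionBy.nsmul_iff.2 hP⟩
  have h2 := hu ⟨Q 1, AddSubgroup.torsionBy.nsmul_iff.2 hQ⟩
  exact not_swap_of_isSquare hsq (σ := σ) h.two_nsmul_left_one h.left_one_ne_right_one
    (h.isSwap_unique h1 (isSwap_self _ _)) (h.isSwap_unique h2 (isSwap_self _ _).symm)

lemma hasVerticalTanglement_two {E : WeierstrassCurve ℚ} [E.IsElliptic] (hsq : IsSquare E.Δ) :
    HasVerticalTanglement E 2 := by
  obtain ⟨P, Q, h⟩ := exists_isTwoPowerBasis E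
  have hPT := mem_tate_two_of_zero h.left_zero h.left_succ
  have hQT := mem_tate_two_of_zero h.right_zero h.right_succ
  obtain ⟨u, hu⟩ := exists_automorphism_of_rel (A := tate E 2)
    (fun R S => ∀ k, IsSwap (P k) (Q k) (R.1 k) (S.1 k))
    (fun R => by
      choose a b hab using fun k => h.span k (R.1 k)
        (AddSubgroup.torsionBy.nsmul_iff.1 (R.2 k).1)
      have hsw : ∀ k, IsSwap (P k) (Q k) (R.1 k) (b k • P k + a k • Q k) :=
        fun k => ⟨a k, b k, hab k, rfl⟩
      refine ⟨⟨fun k => b k • P k + a k • Q k, mem_tate_two_of_zero ?_ fun k => ?_⟩, hsw⟩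
      · rw [h.left_zero, h.right_zero, smul_zero, smul_zero, add_zero]
      · have := (hsw (k + 1)).two_nsmul
        rw [h.left_succ, h.right_succ, (R.2 k).2] at this
        exact h.isSwap_unique this (hsw k))
    (fun h1 h2 => Subtype.ext (funext fun k => h.isSwap_unique (h1 k) (h2 k)))
    (fun h1 k => (h1 k).symm) (fun h1 h2 k => (h1 k).add (h2 k))
  intro hsurj
  obtain ⟨σ, rfl⟩ := hsurj u
  have h1 := hu ⟨P, hPT⟩ 1
  have h2 := hu ⟨Q, hQT⟩ 1
  exact not_swap_of_isSquare hsq (σ := σ) h.two_nsmul_left_one h.left_one_ne_right_one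
    (h.isSwap_unique h1 (isSwap_self _ _)) (h.isSwap_unique h2 (isSwap_self _ _).symm)

/-! ### Cartan normalizers -/

/-- If the discriminant is a square, no matrix in the two-adic image reduces modulo two to an
involution which is not the identity. The kernel of `T₂ E → E[2]` is `2 • T₂ E`, so such a matrix
would interchange two points of order two. -/
lemma exists_mulVec_sub_eq_two_nsmul {E : WeierstrassCurve ℚ} [E.IsElliptic]
    (hsq : IsSquare E.Δ) {e : tate E 2 ≃+ (Fin 2 → ℤ_[2])} {g : GL (Fin 2) ℤ_[2]}
    (hg : g ∈ adicImage E 2 e) {w w' : Fin 2 → ℤ_[2]}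
    (hw : g.1.mulVec (g.1.mulVec w) = w + 2 • w') : ∃ z, g.1.mulVec w - w = 2 • z := by
  obtain ⟨σ, hσ⟩ := hg
  set ρ := (rhoAdic E 2 σ).1
  by_contra! hne
  have htwo : ∀ R : tate E 2, 2 • R.1 1 = 0 := fun R => by
    simpa using AddSubgroup.torsionBy.nsmul_iff.1 (R.2 1).1
  have happly : ∀ R : tate E 2, galPoint E σ (R.1 1) = (ρ R).1 1 := fun _ => rfl
  refine not_swap_of_isSquare hsq (σ := σ) (htwo (e.symm w)) (fun heq => ?_) (happly _) ?_
  · -- the shift of an element of the Tate module with vanishing first term halves it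
    set R := ρ (e.symm w) - e.symm w with hR
    have hR1 : R.1 1 = 0 := by
      change (ρ (e.symm w)).1 1 - (e.symm w).1 1 = 0
      rw [heq, sub_self]
    have hS : (fun k => R.1 (k + 1)) ∈ tate E 2 :=
      mem_tate_two_of_zero hR1 fun k => (R.2 (k + 1)).2
    refine hne (e ⟨_, hS⟩) ?_
    rw [← map_nsmul, show 2 • (⟨_, hS⟩ : tate E 2) = R from
      Subtype.ext (funext fun k => (R.2 k).2), hR, map_sub, hσ, e.apply_symm_apply]
  · have : ρ (ρ (e.symm w)) = e.symm w + 2 • e.symm w' := e.injective (by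
      rw [hσ, hσ, map_add, map_nsmul, e.apply_symm_apply, e.apply_symm_apply, hw])
    rw [happly, this]
    change (e.symm w).1 1 + 2 • (e.symm w').1 1 = _
    rw [htwo, add_zero]

lemma norm_intCast_eq_one_of_odd {n : ℤ} (hn : Odd n) : ‖(n : ℤ_[2])‖ = 1 := by
  refine le_antisymm (PadicInt.norm_le_one _) (not_lt.1 fun h => ?_)
  rw [PadicInt.norm_intCast_lt_one_iff] at h
  exact Int.not_even_iff_odd.2 hn (even_iff_two_dvd.2 (by exact_mod_cast h))

lemma intCast_ne_two_nsmul_of_odd {n : ℤ} (hn : Odd n) (z : ℤ_[2]) : (n : ℤ_[2]) ≠ 2 • z := by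
  intro h
  have h1 := norm_intCast_eq_one_of_odd hn
  have h2 : ‖(2 : ℤ_[2])‖ < 1 := by
    have := (PadicInt.norm_int_lt_one_iff_dvd (p := 2) 2).2 (by norm_num)
    exact_mod_cast this
  rw [h, nsmul_eq_mul, norm_mul] at h1
  push_cast at h1
  nlinarith [PadicInt.norm_le_one z, norm_nonneg (2 : ℤ_[2])]

/-- An integral matrix of odd determinant, as an element of `GL(2, ℤ₂)`. -/
def oddMatrix (a b c d : ℤ) (h : Odd (a * d - b * c)) : GL (Fin 2) ℤ_[2] :=
  Matrix.GeneralLinearGroup.mk'' !![(a : ℤ_[2]), b; c, d] (by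
    rw [Matrix.det_fin_two_of, PadicInt.isUnit_iff]
    exact_mod_cast norm_intCast_eq_one_of_odd h)

lemma coe_oddMatrix {a b c d : ℤ} (h : Odd (a * d - b * c)) :
    (oddMatrix a b c d h).1 = !![(a : ℤ_[2]), b; c, d] := rfl

lemma oddMatrix_mem_cartanNormalizerAdic {δ φ a b c d : ℤ} {h : Odd (a * d - b * c)}
    (hmem : (a = d + b * φ ∧ c = δ * b) ∨ (a = -1 ∧ b = 0 ∧ c = φ ∧ d = 1)) :
    oddMatrix a b c d h ∈ cartanNormalizerAdic δ φ 2 := by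
  refine Subgroup.mem_iInf.2 fun k => Subgroup.mem_comap.2 (Subgroup.subset_closure ?_)
  have hval : (Matrix.GeneralLinearGroup.map (PadicInt.toZModPow (p := 2) k)
      (oddMatrix a b c d h)).1 = !![(a : ZMod (2 ^ k)), b; c, d] := by
    change (oddMatrix a b c d h).1.map _ = _
    rw [coe_oddMatrix]
    ext i j
    fin_cases i <;> fin_cases j <;> simp
  rcases hmem with ⟨rfl, rfl⟩ | ⟨rfl, rfl, rfl, rfl⟩
  · refine .inl ⟨d, b, ?_⟩
    rw [hval]
    push_cast
    rfl
  · right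
    rw [Set.mem_ofPred_eq, hval]
    simp

/-- Each group `N_{δ,φ}(2^∞)` contains a matrix which reduces to a transposition in
`GL(2, 𝔽₂)`. -/
lemma adicImage_ne_cartanNormalizerAdic {E : WeierstrassCurve ℚ} [E.IsElliptic]
    (hsq : IsSquare E.Δ) (δ φ : ℤ) (e : tate E 2 ≃+ (Fin 2 → ℤ_[2])) :
    adicImage E 2 e ≠ (cartanNormalizerAdic δ φ 2 : Set (GL (Fin 2) ℤ_[2])) := by
  intro heq
  have key : ∀ {a b c d : ℤ} {h : Odd (a * d - b * c)},
      oddMatrix a b c d h ∈ cartanNormalizerAdic δ φ 2 → ∀ x y x' y' : ℤ,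
      a * (a * x + b * y) + b * (c * x + d * y) = x + 2 * x' →
      c * (a * x + b * y) + d * (c * x + d * y) = y + 2 * y' →
      (Odd (a * x + b * y - x) ∨ Odd (c * x + d * y - y)) → False := by
    intro a b c d h hmem x y x' y' h1 h2 hodd
    rw [← SetLike.mem_coe, ← heq] at hmem
    have hmul : ∀ x y : ℤ, (oddMatrix a b c d h).1.mulVec ![(x : ℤ_[2]), y] =
        ![((a * x + b * y : ℤ) : ℤ_[2]), ((c * x + d * y : ℤ) : ℤ_[2])] := fun x y => by
      rw [coe_oddMatrix]
      ext i
      fin_cases i <;> simp [mul_comm]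
    obtain ⟨z, hz⟩ := exists_mulVec_sub_eq_two_nsmul hsq hmem
      (w := ![(x : ℤ_[2]), y]) (w' := ![(x' : ℤ_[2]), y']) (by
        rw [hmul, hmul, h1, h2]
        ext i
        fin_cases i <;> simp)
    rw [hmul] at hz
    rcases hodd with hodd | hodd
    · refine intCast_ne_two_nsmul_of_odd hodd (z 0) ?_
      simpa using congrFun hz 0
    · refine intCast_ne_two_nsmul_of_odd hodd (z 1) ?_
      simpa using congrFun hz 1
  rcases Int.even_or_odd' φ with ⟨m, rfl | rfl⟩
  · rcases Int.even_or_odd' δ with ⟨l, rfl | rfl⟩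
    · exact key (a := 1 + 2 * m) (b := 1) (c := 2 * l) (d := 1) (h := ⟨m - l, by ring⟩)
        (oddMatrix_mem_cartanNormalizerAdic (.inl ⟨by ring, by ring⟩)) 0 1 (1 + m) l
        (by ring) (by ring) (.inl ⟨0, by ring⟩)
    · exact key (a := 2 * m) (b := 1) (c := 2 * l + 1) (d := 0) (h := ⟨-l - 1, by ring⟩)
        (oddMatrix_mem_cartanNormalizerAdic (.inl ⟨by ring, by ring⟩)) 1 0 (2 * m ^ 2 + l)
        ((2 * l + 1) * m) (by ring) (by ring) (.inr ⟨l, by ring⟩)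
  · exact key (a := -1) (b := 0) (c := 2 * m + 1) (d := 1) (h := ⟨-1, by ring⟩)
      (oddMatrix_mem_cartanNormalizerAdic (.inr ⟨rfl, rfl, rfl, rfl⟩)) 1 0 0 0
      (by ring) (by ring) (.inr ⟨m, by ring⟩)

end EllipticEntanglement

end

theorem mainTheorem8 (E : WeierstrassCurve ℚ) [E.IsElliptic]
    (W : WeierstrassCurve ℤ)
    (hW : ∃ C : WeierstrassCurve.VariableChange ℚ, C • E = W.baseChange ℚ) :
    (¬ IsSquare (W.Δ : ℚ) →
      EllipticEntanglement.HasWeilEntanglement E 2 (4 * W.Δ.natAbs) (Multiplicative (ZMod 2)) ∧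
      EllipticEntanglement.divField E 2 ⊓ EllipticEntanglement.cyclo (4 * W.Δ.natAbs) =
        EllipticEntanglement.sqrtField (W.Δ : ℚ)) ∧
    (IsSquare (W.Δ : ℚ) →
      EllipticEntanglement.HasVerticalTanglement E 2 ∧
      ¬ Function.Surjective (EllipticEntanglement.rhoMod E 2) ∧
      ∀ (δ φ : ℤ) (e : EllipticEntanglement.tate E 2 ≃+ (Fin 2 → ℤ_[2])),
        EllipticEntanglement.adicImage E 2 e ≠
          (EllipticEntanglement.cartanNormalizerAdic δ φ 2 : Set (GL (Fin 2) ℤ_[2]))) := by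
  obtain ⟨C, hC⟩ := hW
  -- a change of model multiplies the discriminant by the square of a nonzero rational number
  obtain ⟨v, hv, hvΔ⟩ : ∃ v : ℚ, v ≠ 0 ∧ (W.Δ : ℚ) = v ^ 2 * E.Δ := by
    refine ⟨(C.u⁻¹ : ℚˣ) ^ 6, pow_ne_zero 6 (Units.ne_zero _), ?_⟩
    have h := congrArg WeierstrassCurve.Δ hC
    rw [WeierstrassCurve.variableChange_Δ, WeierstrassCurve.baseChange,
      WeierstrassCurve.map_Δ] at h
    rw [← pow_mul]
    exact h.symm
  have hsq : IsSquare (W.Δ : ℚ) ↔ IsSquare E.Δ := by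
    rw [hvΔ]
    constructor
    · rintro ⟨q, hq⟩
      exact ⟨q / v, by field_simp; linear_combination hq⟩
    · rintro ⟨q, hq⟩
      exact ⟨v * q, by rw [hq]; ring⟩
  have hW0 : W.Δ ≠ 0 := fun h0 => by
    rw [h0, Int.cast_zero, zero_eq_mul] at hvΔ
    exact hvΔ.elim (pow_ne_zero 2 hv) E.isUnit_Δ.ne_zero
  have hpos : 0 < W.Δ.natAbs := Int.natAbs_pos.2 hW0
  have hsqrt : EllipticEntanglement.sqrtField (W.Δ : ℚ) = EllipticEntanglement.sqrtField E.Δ := by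
    rw [hvΔ, EllipticEntanglement.sqrtField_mul_sq hv]
  refine ⟨fun hns => ?_, fun hs => ?_⟩
  · have hle : EllipticEntanglement.sqrtField (W.Δ : ℚ) ≤
        EllipticEntanglement.cyclo (4 * W.Δ.natAbs) :=
      IntermediateField.adjoin_le_iff.2 fun z (hz : z ^ 2 = _) =>
        EllipticEntanglement.mem_cyclo_of_sq_eq_intCast (by rw [hz, map_intCast])
    have hinf := EllipticEntanglement.divField_inf_cyclo (E := E) (fun h => hns (hsq.2 h))
      (by positivity : 0 < 4 * W.Δ.natAbs) (hsqrt ▸ hle)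
    rw [← hsqrt] at hinf
    refine ⟨⟨two_pos, by omega, .inl ?_⟩, hinf⟩
    rw [Nat.gcd_eq_left ⟨2 * W.Δ.natAbs, by ring⟩, EllipticEntanglement.cyclo_two, inf_assoc,
      inf_eq_right.2 (EllipticEntanglement.cyclo_le_qAb (by positivity)), hinf]
    exact EllipticEntanglement.galIso_bot_sqrtField hns
  · have hE := hsq.1 hs
    exact ⟨EllipticEntanglement.hasVerticalTanglement_two hE,
      EllipticEntanglement.not_surjective_rhoMod_two hE,
      EllipticEntanglement.adicImage_ne_cartanNormalizerAdic hE⟩
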